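/- Let $\mathbb{F}$ be a field. For a Lie algebra $L$ over $\mathbb{F}$, the nonabelian tensor square $L\otimes L$ is the Lie algebra over $\mathbb{F}$ generated by the symbols $l\otimes k$ ($l,k\in L$) subject to the relations $$c(l\otimes k)=cl\otimes k=l\otimes ck,\quad (l+l')\otimes k=l\otimes k+l'\otimes k,\quad l\otimes(k+k')=l\otimes k+l\otimes k',$$ $$[l,l']\otimes k=l\otimes[l',k]-l'\otimes[l,k],\quad l\otimes[k,k']=[k',l]\otimes k-[k,l]\otimes k',\quad [l\otimes k,l'\otimes k']=-[k,l]\otimes[l',k']$$ for all $c\in\mathbb{F}$ and $l,l',k,k'\in L$. The nonabelian exterior square is $L\wedge L=(L\otimes L)/(L\,\square\,L)$, where $L\,\square\,L$ is the ideal of $L\otimes L$ generated by the elements $l\otimes l$, $l\in L$. Let $A(n)$ be the abelian Lie algebra of dimension $n$ over $\mathbb{F}$, and let $H(m)$ be the Heisenberg Lie algebra with basis $x_1,\dots,x_{2m},x$ and brackets $[x_{2i-1},x_{2i}]=x=-[x_{2i},x_{2i-1}]$ for $1\le i\le m$, all other brackets of basis elements being zero. Let $L_{4,3}$ be the Lie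 algebra with basis $x_1,\dots,x_4$ and $[x_1,x_2]=x_3$, $[x_1,x_3]=x_4$. Put $$L_{5,1}=A(5),\quad L_{5,2}=H(1)\oplus A(2),\quad L_{5,3}=L_{4,3}\oplus A(1),\quad L_{5,4}=H(2),$$ and let $L_{5,5},\dots,L_{5,9}$ be the Lie algebras with basis $x_1,\dots,x_5$ and brackets - $L_{5,5}$: $[x_1,x_2]=x_3,\ [x_1,x_3]=[x_2,x_4]=x_5$; - $L_{5,6}$: $[x_1,x_2]=x_3,\ [x_1,x_3]=x_4,\ [x_1,x_4]=[x_2,x_3]=x_5$; - $L_{5,7}$: $[x_1,x_2]=x_3,\ [x_1,x_3]=x_4,\ [x_1,x_4]=x_5$; - $L_{5,8}$: $[x_1,x_2]=x_4,\ [x_1,x_3]=x_5$; - $L_{5,9}$: $[x_1,x_2]=x_3,\ [x_1,x_3]=x_4,\ [x_2,x_3]=x_5$ (brackets of basis elements that are neither listed nor determined by antisymmetry are zero). Then, as Lie algebras over $\mathbb{F}$, $$L_{5,k}\wedge L_{5,k}\cong\begin{cases}A(6)&\text{if }k=3,4,5,9,\\ A(8)&\text{if }k=2,8,\\ A(10)&\text{if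 }k=1,\\ H(1)\oplus A(3)&\text{if }k=6,7.\end{cases}$$ -/

import Mathlib

noncomputable section

namespace LieExt

universe u v

/-! ### Nonabelian tensor square and nonabelian exterior square -/

section Square

variable (F : Type u) [Field F] (L : Type v) [LieRing L] [LieAlgebra F L]

/-- The defining relations of the nonabelian tensor square `L ⊗ L` on the symbols `l ⊗ k`,
where `L` acts on itself by `^l k = ⁅l, k⁆`. The symbol `l ⊗ k` is the free generator `(l, k)`. -/
inductive TensorRel : FreeLieAlgebra F (L × L) → FreeLieAlgebra F (L × L) → Prop
  | smul_left (c : F) (l k : L) :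
      TensorRel (c • FreeLieAlgebra.of F (l, k)) (FreeLieAlgebra.of F (c • l, k))
  | smul_right (c : F) (l k : L) :
      TensorRel (c • FreeLieAlgebra.of F (l, k)) (FreeLieAlgebra.of F (l, c • k))
  | add_left (l l' k : L) :
      TensorRel (FreeLieAlgebra.of F (l + l', k))
        (FreeLieAlgebra.of F (l, k) + FreeLieAlgebra.of F (l', k))
  | add_right (l k k' : L) :
      TensorRel (FreeLieAlgebra.of F (l, k + k'))
        (FreeLieAlgebra.of F (l, k) + FreeLieAlgebra.of F (l, k'))
  | lie_left (l l' k : L) :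
      TensorRel (FreeLieAlgebra.of F (⁅l, l'⁆, k))
        (FreeLieAlgebra.of F (l, ⁅l', k⁆) - FreeLieAlgebra.of F (l', ⁅l, k⁆))
  | lie_right (l k k' : L) :
      TensorRel (FreeLieAlgebra.of F (l, ⁅k, k'⁆))
        (FreeLieAlgebra.of F (⁅k', l⁆, k) - FreeLieAlgebra.of F (⁅k, l⁆, k'))
  | lie_lie (l k l' k' : L) :
      TensorRel ⁅FreeLieAlgebra.of F (l, k), FreeLieAlgebra.of F (l', k')⁆
        (-FreeLieAlgebra.of F (⁅k, l⁆, ⁅l', k'⁆))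

/-- The ideal of the free Lie algebra on the symbols `l ⊗ k` generated by the relations. -/
def tensorRelIdeal : LieIdeal F (FreeLieAlgebra F (L × L)) :=
  LieSubmodule.lieSpan F (FreeLieAlgebra F (L × L)) {z | ∃ a b, TensorRel F L a b ∧ z = a - b}

/-- The nonabelian tensor square `L ⊗ L`. -/
abbrev TensorSquare : Type (max u v) := FreeLieAlgebra F (L × L) ⧸ tensorRelIdeal F L

variable {L} in
/-- The element `l ⊗ k` of the nonabelian tensor square. -/
def tmul (l k : L) : TensorSquare F L :=
  LieSubmodule.Quotient.mk (FreeLieAlgebra.of F (l, k))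

/-- The diagonal ideal `L □ L` of `L ⊗ L`, generated by the elements `l ⊗ l`. -/
def diagonalIdeal : LieIdeal F (TensorSquare F L) :=
  LieSubmodule.lieSpan F (TensorSquare F L) (Set.range fun l : L => tmul F l l)

/-- The nonabelian exterior square `L ∧ L = (L ⊗ L) / (L □ L)`. -/
abbrev ExteriorSquare : Type (max u v) := TensorSquare F L ⧸ diagonalIdeal F L

end Square

/-! ### Abelian Lie algebras `A(n)` -/

section Abelian

variable (F : Type u) [Field F] (n : ℕ)

/-- `A(n)`: the abelian Lie algebra of dimension `n`. -/
def A : Type u := Fin n → F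

instance : AddCommGroup (A F n) := inferInstanceAs (AddCommGroup (Fin n → F))
instance : Module F (A F n) := inferInstanceAs (Module F (Fin n → F))

instance : LieRing (A F n) where
  bracket _ _ := 0
  add_lie _ _ _ := (add_zero 0).symm
  lie_add _ _ _ := (add_zero 0).symm
  lie_self _ := rfl
  leibniz_lie _ _ _ := (add_zero 0).symm

instance : LieAlgebra F (A F n) where
  lie_smul c _ _ := (smul_zero c).symm

end Abelian

/-! ### Heisenberg Lie algebras `H(m)` -/

section Heisenberg

variable (F : Type u) [Field F] (m : ℕ)

/-- `H(m)`: the Heisenberg Lie algebra of dimension `2 * m + 1`. The three components are the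
coordinates along `x₁, x₃, …, x₂ₘ₋₁`, along `x₂, x₄, …, x₂ₘ`, and along the central element `x`;
the nonzero brackets of basis elements are `⁅x₂ᵢ₋₁, x₂ᵢ⁆ = x = -⁅x₂ᵢ, x₂ᵢ₋₁⁆`. -/
def H : Type u := (Fin m → F) × (Fin m → F) × F

instance : AddCommGroup (H F m) := inferInstanceAs (AddCommGroup ((Fin m → F) × (Fin m → F) × F))
instance : Module F (H F m) := inferInstanceAs (Module F ((Fin m → F) × (Fin m → F) × F))

/-- The bracket of `H(m)`. -/
def H.bracket (v w : (Fin m → F) × (Fin m → F) × F) : (Fin m → F) × (Fin m → F) × F :=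
  (0, 0, ∑ i, (v.1 i * w.2.1 i - v.2.1 i * w.1 i))

instance : LieRing (H F m) where
  bracket := H.bracket F m
  add_lie u v w := by
    change H.bracket F m (u + v) w = H.bracket F m u w + H.bracket F m v w
    simp only [H.bracket, Prod.mk_add_mk, add_zero, ← Finset.sum_add_distrib]
    refine congrArg (fun t => (0, 0, t)) (Finset.sum_congr rfl fun i _ => ?_)
    change (u.1 i + v.1 i) * _ - (u.2.1 i + v.2.1 i) * _ = _
    ring
  lie_add u v w := by
    change H.bracket F m u (v + w) = H.bracket F m u v + H.bracket F m u w
    simp only [H.bracket, Prod.mk_add_mk, add_zero, ← Finset.sum_add_distrib]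
    refine congrArg (fun t => (0, 0, t)) (Finset.sum_congr rfl fun i _ => ?_)
    change _ * (v.2.1 i + w.2.1 i) - _ * (v.1 i + w.1 i) = _
    ring
  lie_self v := by
    change H.bracket F m v v = ((0, 0, 0) : (Fin m → F) × (Fin m → F) × F)
    simp [H.bracket, mul_comm]
  leibniz_lie u v w := by
    change H.bracket F m u (H.bracket F m v w) =
      H.bracket F m (H.bracket F m u v) w + H.bracket F m v (H.bracket F m u w)
    simp [H.bracket]

instance : LieAlgebra F (H F m) where
  lie_smul c v w := by
    change H.bracket F m v (c • w) = c • H.bracket F m v w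
    simp only [H.bracket, Prod.smul_mk, smul_zero, Finset.smul_sum]
    refine congrArg (fun t => (0, 0, t)) (Finset.sum_congr rfl fun i _ => ?_)
    change _ * (c * w.2.1 i) - _ * (c * w.1 i) = c * _
    ring

end Heisenberg

/-! ### Lie algebras given by a table of brackets of basis elements -/

section Table

/-- A bracket table on basis elements `x₀, …, xₙ₋₁`: an entry `(i, j, k)` with `i < j` stands for
a summand `x_k` in `⁅x_i, x_j⁆` (and `-x_k` in `⁅x_j, x_i⁆`); brackets of basis elements not listed
are zero. -/
abbrev Table (n : ℕ) : Type := List (Fin n × Fin n × Fin n)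

variable (F : Type u) [Field F] {n : ℕ}

/-- The bilinear alternating bracket on `Fⁿ` prescribed by a table. -/
def Table.bracket (T : Table n) (v w : Fin n → F) : Fin n → F := fun k =>
  (T.map fun r => if r.2.2 = k then v r.1 * w r.2.1 - v r.2.1 * w r.1 else 0).sum

/-- The bracket prescribed by the table satisfies the Jacobi (Leibniz) identity. -/
class Table.IsLie (T : Table n) : Prop where
  leibniz : ∀ u v w : Fin n → F, T.bracket F u (T.bracket F v w) =
    T.bracket F (T.bracket F u v) w + T.bracket F v (T.bracket F u w)

/-- The `n`-dimensional space `Fⁿ`, to be equipped with the bracket of the table `T`. -/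
def TableAlg (_T : Table n) : Type u := Fin n → F

variable (T : Table n)

instance : AddCommGroup (TableAlg F T) := inferInstanceAs (AddCommGroup (Fin n → F))
instance : Module F (TableAlg F T) := inferInstanceAs (Module F (Fin n → F))

theorem Table.bracket_add_left (u v w : Fin n → F) :
    T.bracket F (u + v) w = T.bracket F u w + T.bracket F v w := by
  funext k
  induction T with
  | nil => simp [Table.bracket]
  | cons r T ih =>
    simp only [Table.bracket, Pi.add_apply, List.map_cons, List.sum_cons] at ih ⊢
    rw [ih]
    split_ifs <;> ring

theorem Table.bracket_add_right (u v w : Fin n → F) :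
    T.bracket F u (v + w) = T.bracket F u v + T.bracket F u w := by
  funext k
  induction T with
  | nil => simp [Table.bracket]
  | cons r T ih =>
    simp only [Table.bracket, Pi.add_apply, List.map_cons, List.sum_cons] at ih ⊢
    rw [ih]
    split_ifs <;> ring

theorem Table.bracket_smul_right (c : F) (v w : Fin n → F) :
    T.bracket F v (c • w) = c • T.bracket F v w := by
  funext k
  induction T with
  | nil => simp [Table.bracket]
  | cons r T ih =>
    simp only [Table.bracket, Pi.smul_apply, smul_eq_mul, List.map_cons, List.sum_cons] at ih ⊢
    rw [ih]
    split_ifs <;> ring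

theorem Table.bracket_self (v : Fin n → F) : T.bracket F v v = 0 := by
  funext k
  simp [Table.bracket, mul_comm]

instance [T.IsLie F] : LieRing (TableAlg F T) where
  bracket := T.bracket F
  add_lie := T.bracket_add_left F
  lie_add := T.bracket_add_right F
  lie_self := T.bracket_self F
  leibniz_lie := Table.IsLie.leibniz

instance [T.IsLie F] : LieAlgebra F (TableAlg F T) where
  lie_smul := T.bracket_smul_right F

end Table

/-! ### The tables. The basis element `x_i` has index `i - 1`. -/

/-- `⁅x₁, x₂⁆ = x₃`, `⁅x₁, x₃⁆ = x₄`, in dimension four. -/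
def T4_3 : Table 4 := [(0, 1, 2), (0, 2, 3)]

/-- `⁅x₁, x₂⁆ = x₃`, `⁅x₁, x₃⁆ = ⁅x₂, x₄⁆ = x₅`. -/
def T5_5 : Table 5 := [(0, 1, 2), (0, 2, 4), (1, 3, 4)]

/-- `⁅x₁, x₂⁆ = x₃`, `⁅x₁, x₃⁆ = x₄`, `⁅x₁, x₄⁆ = ⁅x₂, x₃⁆ = x₅`. -/
def T5_6 : Table 5 := [(0, 1, 2), (0, 2, 3), (0, 3, 4), (1, 2, 4)]

/-- `⁅x₁, x₂⁆ = x₃`, `⁅x₁, x₃⁆ = x₄`, `⁅x₁, x₄⁆ = x₅`. -/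
def T5_7 : Table 5 := [(0, 1, 2), (0, 2, 3), (0, 3, 4)]

/-- `⁅x₁, x₂⁆ = x₄`, `⁅x₁, x₃⁆ = x₅`. -/
def T5_8 : Table 5 := [(0, 1, 3), (0, 2, 4)]

/-- `⁅x₁, x₂⁆ = x₃`, `⁅x₁, x₃⁆ = x₄`, `⁅x₂, x₃⁆ = x₅`. -/
def T5_9 : Table 5 := [(0, 1, 2), (0, 2, 3), (1, 2, 4)]

section Instances

variable (F : Type u) [Field F]

instance : T4_3.IsLie F := ⟨fun u v w => by
  funext k; fin_cases k <;> simp [Table.bracket, T4_3] <;> ring⟩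

instance : T5_5.IsLie F := ⟨fun u v w => by
  funext k; fin_cases k <;> simp [Table.bracket, T5_5] <;> ring⟩

instance : T5_6.IsLie F := ⟨fun u v w => by
  funext k; fin_cases k <;> simp [Table.bracket, T5_6] <;> ring⟩

instance : T5_7.IsLie F := ⟨fun u v w => by
  funext k; fin_cases k <;> simp [Table.bracket, T5_7] <;> ring⟩

instance : T5_8.IsLie F := ⟨fun u v w => by
  funext k; fin_cases k <;> simp [Table.bracket, T5_8]⟩

instance : T5_9.IsLie F := ⟨fun u v w => by
  funext k; fin_cases k <;> simp [Table.bracket, T5_9] <;> ring⟩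

end Instances

/-! ### The five-dimensional nilpotent Lie algebras `L_{5,1}, …, L_{5,9}`

The direct sum of Lie algebras is the product with the componentwise bracket. -/

section List5

variable (F : Type u) [Field F]

/-- `L_{4,3}` -/
abbrev L4_3 : Type u := TableAlg F T4_3
/-- `L_{5,1} = A(5)` -/
abbrev L5_1 : Type u := A F 5
/-- `L_{5,2} = H(1) ⊕ A(2)` -/
abbrev L5_2 : Type u := H F 1 × A F 2
/-- `L_{5,3} = L_{4,3} ⊕ A(1)` -/
abbrev L5_3 : Type u := L4_3 F × A F 1
/-- `L_{5,4} = H(2)` -/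
abbrev L5_4 : Type u := H F 2
/-- `L_{5,5}` -/
abbrev L5_5 : Type u := TableAlg F T5_5
/-- `L_{5,6}` -/
abbrev L5_6 : Type u := TableAlg F T5_6
/-- `L_{5,7}` -/
abbrev L5_7 : Type u := TableAlg F T5_7
/-- `L_{5,8}` -/
abbrev L5_8 : Type u := TableAlg F T5_8
/-- `L_{5,9}` -/
abbrev L5_9 : Type u := TableAlg F T5_9

end List5

end LieExt

end

/-!
The relations of `L ⊗ L` make the bracket of two symbols a symbol again, so `L ∧ L` is spanned
as a vector space by the elements `l ∧ k`, which are bilinear and alternating. As a vector space it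
is the quotient of `Λ² L` by the Jacobi relations
`[l, l'] ∧ k = l ∧ [l', k] - l' ∧ [l, k]`, and its bracket is
`[l ∧ k, l' ∧ k'] = [l, k] ∧ [l', k']`.

To identify `L ∧ L` with a given Lie algebra `M` it is therefore enough to give an alternating
bilinear map `β : L × L → M` satisfying these two identities, and a linear map `M → L ∧ L` that
takes `β l k` to `l ∧ k`, provided the values of `β` span `M`; this is
`nonempty_exteriorSquare_equiv`, which rests on `span_wedge` and the universal property
`exists_lift`. In bases of `L` and `M` (see
`nonempty_exteriorSquare_equiv_of_coordinates`) the map `β` becomes a list of minors, the two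
identities for `β` become polynomial identities over `ℤ`, and the linear map exists as soon as the
Jacobi relations reduce the `x_i ∧ x_j` with `i < j` to the chosen basis. For the nine algebras
there are at most four independent relations. The elements `a ∧ b` with `a, b ∈ [L, L]`
vanish except for `L_{5,6}` and `L_{5,7}`, where they fill the line through
`x₃ ∧ x₄ = -x₂ ∧ x₅`; this line is the centre of the Heisenberg factor.
-/

namespace LieExt

universe u v w

/-! ### The universal property of the exterior square -/

section Universal

variable {F : Type u} [Field F] {L : Type v} [LieRing L] [LieAlgebra F L]

theorem tmul_eq_of_rel {a b : FreeLieAlgebra F (L × L)} (h : TensorRel F L a b) :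
    (LieSubmodule.Quotient.mk a : TensorSquare F L) = LieSubmodule.Quotient.mk b :=
  (Submodule.Quotient.eq _).2 (LieSubmodule.subset_lieSpan ⟨a, b, h, rfl⟩)

variable (F L) in
/-- The element `l ∧ k` of the nonabelian exterior square, as a bilinear map in `l` and `k`. -/
noncomputable def wedge : L →ₗ[F] L →ₗ[F] ExteriorSquare F L :=
  LinearMap.mk₂ F (fun l k => LieSubmodule.Quotient.mk (tmul F l k))
    (fun l l' k => congrArg _ (tmul_eq_of_rel (.add_left l l' k)))
    (fun c l k => congrArg _ (tmul_eq_of_rel (.smul_left c l k)).symm)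
    (fun l k k' => congrArg _ (tmul_eq_of_rel (.add_right l k k')))
    (fun c l k => congrArg _ (tmul_eq_of_rel (.smul_right c l k)).symm)

theorem wedge_self (l : L) : wedge F L l l = 0 :=
  (LieSubmodule.Quotient.mk_eq_zero' (N := diagonalIdeal F L)).2
    (LieSubmodule.subset_lieSpan ⟨l, rfl⟩)

theorem wedge_lie_left (l l' k : L) :
    wedge F L ⁅l, l'⁆ k = wedge F L l ⁅l', k⁆ - wedge F L l' ⁅l, k⁆ :=
  congrArg _ (tmul_eq_of_rel (.lie_left l l' k))

theorem lie_wedge_wedge (l k l' k' : L) :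
    ⁅wedge F L l k, wedge F L l' k'⁆ = wedge F L ⁅l, k⁆ ⁅l', k'⁆ := by
  have h : ⁅wedge F L l k, wedge F L l' k'⁆ = -wedge F L ⁅k, l⁆ ⁅l', k'⁆ :=
    congrArg (LieSubmodule.Quotient.mk (N := diagonalIdeal F L))
      (tmul_eq_of_rel (.lie_lie l k l' k'))
  rw [h, ← lie_skew l k, map_neg, LinearMap.neg_apply]

/-- The bracket of two elements `l ∧ k` is again such an element, so they span `L ∧ L` not only
as a Lie algebra but as a vector space. -/
theorem span_wedge :
    Submodule.span F (Set.range fun p : L × L => wedge F L p.1 p.2) = ⊤ := by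
  set S := Submodule.span F (Set.range fun p : L × L => wedge F L p.1 p.2) with hS
  let K : LieSubalgebra F (ExteriorSquare F L) :=
    { S with
      lie_mem' := by
        intro x y hx hy
        change ⁅x, y⁆ ∈ S
        induction hx using Submodule.span_induction with
        | zero => simp
        | add x₁ x₂ _ _ h₁ h₂ => rw [add_lie]; exact S.add_mem h₁ h₂
        | smul c x _ h => rw [smul_lie]; exact S.smul_mem c h
        | mem x hx =>
          obtain ⟨⟨l, k⟩, rfl⟩ := hx
          induction hy using Submodule.span_induction with
          | zero => simp
          | add x₁ x₂ _ _ h₁ h₂ => rw [lie_add]; exact S.add_mem h₁ h₂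
          | smul c x _ h => rw [lie_smul]; exact S.smul_mem c h
          | mem x hx =>
            obtain ⟨⟨l', k'⟩, rfl⟩ := hx
            simp only [lie_wedge_wedge]
            exact Submodule.subset_span ⟨(⁅l, k⁆, ⁅l', k'⁆), rfl⟩ }
  let q : FreeLieAlgebra F (L × L) →ₗ⁅F⁆ ExteriorSquare F L :=
    { toFun := fun a => LieSubmodule.Quotient.mk (LieSubmodule.Quotient.mk a : TensorSquare F L)
      map_add' := fun _ _ => rfl
      map_smul' := fun _ _ => rfl
      map_lie' := rfl }
  let φ : FreeLieAlgebra F (L × L) →ₗ⁅F⁆ K :=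
    FreeLieAlgebra.lift F fun p => ⟨wedge F L p.1 p.2, Submodule.subset_span ⟨p, rfl⟩⟩
  have hq : K.incl.comp φ = q := by
    refine FreeLieAlgebra.hom_ext fun p => ?_
    simp only [φ, LieHom.comp_apply, FreeLieAlgebra.lift_of_apply]
    rfl
  rw [eq_top_iff]
  rintro z -
  obtain ⟨t, rfl⟩ := LieSubmodule.Quotient.surjective_mk' _ z
  obtain ⟨a, rfl⟩ := LieSubmodule.Quotient.surjective_mk' _ t
  have ha : K.incl (φ a) = q a := by rw [← hq]; rfl
  change q a ∈ S
  rw [← ha]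
  exact (φ a).2

variable {M : Type w} [LieRing M] [LieAlgebra F M]

/-- The universal property of `L ∧ L`. The relation for `l ∧ [k, k']` need not be assumed: it
follows from the one for `[l, l'] ∧ k` since `β` is alternating. -/
theorem exists_lift (β : L →ₗ[F] L →ₗ[F] M) (hself : ∀ l, β l l = 0)
    (hleft : ∀ l l' k, β ⁅l, l'⁆ k = β l ⁅l', k⁆ - β l' ⁅l, k⁆)
    (hlie : ∀ l k l' k', ⁅β l k, β l' k'⁆ = β ⁅l, k⁆ ⁅l', k'⁆) :
    ∃ f : ExteriorSquare F L →ₗ⁅F⁆ M, ∀ l k, f (wedge F L l k) = β l k := by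
  have hswap : ∀ l k, β l k = -β k l := fun l k => by
    have h := hself (l + k)
    simp only [map_add, LinearMap.add_apply, hself, zero_add, add_zero] at h
    exact eq_neg_of_add_eq_zero_right h
  let φ : FreeLieAlgebra F (L × L) →ₗ⁅F⁆ M := FreeLieAlgebra.lift F fun p => β p.1 p.2
  have hφ : ∀ l k, φ (FreeLieAlgebra.of F (l, k)) = β l k := fun l k =>
    FreeLieAlgebra.lift_of_apply _ _
  have hker : tensorRelIdeal F L ≤ φ.ker := by
    refine LieSubmodule.lieSpan_le.2 ?_
    rintro _ ⟨a, b, h, rfl⟩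
    change _ ∈ φ.ker
    rw [LieHom.mem_ker, map_sub, sub_eq_zero]
    cases h with
    | smul_left c l k => simp [hφ]
    | smul_right c l k => simp [hφ]
    | add_left l l' k => simp [hφ]
    | add_right l k k' => simp [hφ]
    | lie_left l l' k => simp [hφ, hleft]
    | lie_right l k k' =>
      -- Swap the arguments of every symbol; what remains is the relation `hleft`.
      rw [map_sub, hφ, hφ, hφ, hswap l, hleft, hswap ⁅k', l⁆, hswap ⁅k, l⁆]
      abel
    | lie_lie l k l' k' =>
      rw [LieHom.map_lie, map_neg, hφ, hφ, hφ, hlie, ← lie_skew l k, map_neg,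
        LinearMap.neg_apply]
  let f₁ : TensorSquare F L →ₗ[F] M := (tensorRelIdeal F L).toSubmodule.liftQ φ.toLinearMap hker
  have hf₁ : ∀ x y : TensorSquare F L, f₁ ⁅x, y⁆ = ⁅f₁ x, f₁ y⁆ := by
    intro x y
    obtain ⟨a, rfl⟩ := LieSubmodule.Quotient.surjective_mk' _ x
    obtain ⟨b, rfl⟩ := LieSubmodule.Quotient.surjective_mk' _ y
    exact φ.map_lie a b
  let φ₁ : TensorSquare F L →ₗ⁅F⁆ M := { f₁ with map_lie' := fun {x y} => hf₁ x y }
  have hker₁ : diagonalIdeal F L ≤ φ₁.ker := by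
    refine LieSubmodule.lieSpan_le.2 ?_
    rintro _ ⟨l, rfl⟩
    change _ ∈ φ₁.ker
    rw [LieHom.mem_ker]
    exact (hφ l l).trans (hself l)
  let f₂ : ExteriorSquare F L →ₗ[F] M := (diagonalIdeal F L).toSubmodule.liftQ φ₁.toLinearMap hker₁
  have hf₂ : ∀ x y : ExteriorSquare F L, f₂ ⁅x, y⁆ = ⁅f₂ x, f₂ y⁆ := by
    intro x y
    obtain ⟨a, rfl⟩ := LieSubmodule.Quotient.surjective_mk' _ x
    obtain ⟨b, rfl⟩ := LieSubmodule.Quotient.surjective_mk' _ y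
    exact φ₁.map_lie a b
  exact ⟨{ f₂ with map_lie' := fun {x y} => hf₂ x y }, hφ⟩

/-- A Lie algebra `M` with a bilinear map `β` that satisfies the relations of `L ∧ L` is isomorphic
to `L ∧ L` as soon as there is a linear map back to `L ∧ L` taking each `β l k` to `l ∧ k`, and the
values of `β` span `M`. -/
theorem nonempty_exteriorSquare_equiv (β : L →ₗ[F] L →ₗ[F] M) (hself : ∀ l, β l l = 0)
    (hleft : ∀ l l' k, β ⁅l, l'⁆ k = β l ⁅l', k⁆ - β l' ⁅l, k⁆)
    (hlie : ∀ l k l' k', ⁅β l k, β l' k'⁆ = β ⁅l, k⁆ ⁅l', k'⁆)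
    (hspan : Submodule.span F (Set.range fun p : L × L => β p.1 p.2) = ⊤)
    (g : M →ₗ[F] ExteriorSquare F L) (hg : ∀ l k, g (β l k) = wedge F L l k) :
    Nonempty (ExteriorSquare F L ≃ₗ⁅F⁆ M) := by
  obtain ⟨f, hf⟩ := exists_lift β hself hleft hlie
  have hgf : g ∘ₗ (f : ExteriorSquare F L →ₗ[F] M) = LinearMap.id := by
    refine LinearMap.ext_on_range (v := fun p : L × L => wedge F L p.1 p.2) span_wedge fun p => ?_
    simp [hf, hg]
  have hfg : (f : ExteriorSquare F L →ₗ[F] M) ∘ₗ g = LinearMap.id := by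
    refine LinearMap.ext_on_range (v := fun p : L × L => β p.1 p.2) hspan fun p => ?_
    simp [hf, hg]
  exact ⟨{ f with
    invFun := g
    left_inv := LinearMap.congr_fun hgf
    right_inv := LinearMap.congr_fun hfg }⟩

end Universal

/-! ### Bilinear maps in coordinates -/

section Coordinates

variable (F : Type u) [Field F] {n m : ℕ}

/-- The alternating bilinear map `Fⁿ × Fⁿ → Fᵐ` given by a list: an entry `(i, j, k)` contributes
the minor `vᵢ wⱼ - vⱼ wᵢ` to the `k`-th coordinate. For `m = n` this is `Table.bracket`. -/
def pairing (S : List (Fin n × Fin n × Fin m)) : (Fin n → F) →ₗ[F] (Fin n → F) →ₗ[F] (Fin m → F) :=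
  LinearMap.mk₂ F
    (fun v w k => (S.map fun r => if r.2.2 = k then v r.1 * w r.2.1 - v r.2.1 * w r.1 else 0).sum)
    (fun u v w => by
      funext k
      rw [Pi.add_apply, ← List.sum_map_add]
      refine congrArg List.sum (List.map_congr_left fun r _ => ?_)
      simp only [Pi.add_apply]
      split_ifs <;> ring)
    (fun c v w => by
      funext k
      rw [Pi.smul_apply, smul_eq_mul, ← List.sum_map_mul_left]
      refine congrArg List.sum (List.map_congr_left fun r _ => ?_)
      simp only [Pi.smul_apply, smul_eq_mul]
      split_ifs <;> ring)
    (fun u v w => by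
      funext k
      rw [Pi.add_apply, ← List.sum_map_add]
      refine congrArg List.sum (List.map_congr_left fun r _ => ?_)
      simp only [Pi.add_apply]
      split_ifs <;> ring)
    (fun c v w => by
      funext k
      rw [Pi.smul_apply, smul_eq_mul, ← List.sum_map_mul_left]
      refine congrArg List.sum (List.map_congr_left fun r _ => ?_)
      simp only [Pi.smul_apply, smul_eq_mul]
      split_ifs <;> ring)

variable {F} in
theorem pairing_apply (S : List (Fin n × Fin n × Fin m)) (v w : Fin n → F) (k : Fin m) :
    pairing F S v w k =
      (S.map fun r => if r.2.2 = k then v r.1 * w r.2.1 - v r.2.1 * w r.1 else 0).sum := rfl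

theorem pairing_self (S : List (Fin n × Fin n × Fin m)) (v : Fin n → F) : pairing F S v v = 0 := by
  funext k
  simp [pairing_apply, mul_comm]

/-- The standard basis vector of `Fⁿ` with index `i`, called `x_{i+1}` in one-based numbering. -/
abbrev std (i : Fin n) : Fin n → F := Pi.single i 1

theorem pairing_std (S : List (Fin n × Fin n × Fin m)) (i j : Fin n) :
    pairing F S (std F i) (std F j) = (S.map fun r =>
      ((if r.1 = i ∧ r.2.1 = j then 1 else 0) - (if r.2.1 = i ∧ r.1 = j then 1 else 0) : F) •
        std F r.2.2).sum := by
  funext k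
  rw [pairing_apply, Pi.list_sum_apply, List.map_map]
  refine congrArg List.sum (List.map_congr_left fun r _ => ?_)
  simp only [Function.comp_apply, Pi.smul_apply, smul_eq_mul, Pi.single_apply, eq_comm (a := k),
    ite_and]
  split_ifs <;> simp

variable {F} in
/-- Two alternating bilinear maps on `Fⁿ` agree if they agree on the pairs of basis vectors
`(x_i, x_j)` with `i < j`. -/
theorem alternating_ext {E : Type*} [AddCommGroup E] [Module F E]
    {B C : (Fin n → F) →ₗ[F] (Fin n → F) →ₗ[F] E} (hB : ∀ v, B v v = 0) (hC : ∀ v, C v v = 0)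
    (h : ∀ i j, i < j → B (std F i) (std F j) = C (std F i) (std F j)) : B = C := by
  have key : ∀ i j, B (std F i) (std F j) = C (std F i) (std F j) := by
    intro i j
    rcases lt_trichotomy i j with hij | rfl | hij
    · exact h i j hij
    · rw [hB, hC]
    · rw [← LinearMap.IsAlt.neg hB, ← LinearMap.IsAlt.neg hC, h j i hij]
  refine (Pi.basisFun F (Fin n)).ext fun i => (Pi.basisFun F (Fin n)).ext fun j => ?_
  simpa using key i j

variable {F}
variable {L : Type v} [LieRing L] [LieAlgebra F L] {M : Type w} [LieRing M] [LieAlgebra F M]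

/-- Coordinate form of `nonempty_exteriorSquare_equiv`. The brackets of `L` and `M` are given by
`T` and `U`, the map `L × L → M` by `S`, and `p k` is a pair of basis vectors of `L` whose
wedge corresponds to the `k`-th basis vector of `M`. In `hrel` the map `W` stands for
`(v, w) ↦ v ∧ w`; the hypothesis says that the Jacobi relations express every `x_i ∧ x_j` through
the wedges `p k`, with the coefficients prescribed by `S`. -/
theorem nonempty_exteriorSquare_equiv_of_coordinates
    (T : List (Fin n × Fin n × Fin n)) (S : List (Fin n × Fin n × Fin m))
    (U : List (Fin m × Fin m × Fin m)) (p : Fin m → Fin n × Fin n)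
    (e : L ≃ₗ[F] (Fin n → F)) (he : ∀ x y, e ⁅x, y⁆ = pairing F T (e x) (e y))
    (e' : M ≃ₗ[F] (Fin m → F)) (he' : ∀ x y, e' ⁅x, y⁆ = pairing F U (e' x) (e' y))
    (hleft : ∀ u v w, pairing F S (pairing F T u v) w =
      pairing F S u (pairing F T v w) - pairing F S v (pairing F T u w))
    (hlie : ∀ u v u' v', pairing F U (pairing F S u v) (pairing F S u' v') =
      pairing F S (pairing F T u v) (pairing F T u' v'))
    (hp : ∀ k, pairing F S (std F (p k).1) (std F (p k).2) = std F k)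
    (hrel : ∀ W : (Fin n → F) →ₗ[F] (Fin n → F) →ₗ[F] ExteriorSquare F L, (∀ v, W v v = 0) →
      (∀ u v w, W (pairing F T u v) w = W u (pairing F T v w) - W v (pairing F T u w)) →
      ∀ i j, i < j → ∑ k, pairing F S (std F i) (std F j) k • W (std F (p k).1) (std F (p k).2) =
        W (std F i) (std F j)) :
    Nonempty (ExteriorSquare F L ≃ₗ⁅F⁆ M) := by
  let W : (Fin n → F) →ₗ[F] (Fin n → F) →ₗ[F] ExteriorSquare F L :=
    (wedge F L).compl₁₂ e.symm.toLinearMap e.symm.toLinearMap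
  have hWself : ∀ v, W v v = 0 := fun v => wedge_self (e.symm v)
  have hT : ∀ v w, e.symm (pairing F T v w) = ⁅e.symm v, e.symm w⁆ := fun v w => by
    rw [LinearEquiv.symm_apply_eq, he, e.apply_symm_apply, e.apply_symm_apply]
  have hWleft : ∀ u v w,
      W (pairing F T u v) w = W u (pairing F T v w) - W v (pairing F T u w) := fun u v w => by
    simp only [W, LinearMap.compl₁₂_apply, LinearEquiv.coe_coe, hT, wedge_lie_left]
  let β : L →ₗ[F] L →ₗ[F] M :=
    ((pairing F S).compl₁₂ e.toLinearMap e.toLinearMap).compr₂ e'.symm.toLinearMap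
  have hβ : ∀ x y, β x y = e'.symm (pairing F S (e x) (e y)) := fun _ _ => rfl
  let g : (Fin m → F) →ₗ[F] ExteriorSquare F L :=
    Fintype.linearCombination F fun k => W (std F (p k).1) (std F (p k).2)
  have hg : (pairing F S).compr₂ g = W := by
    refine alternating_ext (fun v => ?_) hWself fun i j hij => ?_
    · rw [LinearMap.compr₂_apply, pairing_self, map_zero]
    · exact hrel W hWself hWleft i j hij
  refine nonempty_exteriorSquare_equiv β (fun l => ?_) (fun l l' k => ?_) (fun l k l' k' => ?_) ?_
    (g ∘ₗ e'.toLinearMap) (fun l k => ?_)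
  · rw [hβ, pairing_self, map_zero]
  · simp only [hβ, he, hleft, map_sub]
  · rw [← e'.injective.eq_iff]
    simp only [he', hβ, he, e'.apply_symm_apply, hlie]
  · -- By `hp`, every basis vector of `M` is a value of `β`.
    rw [eq_top_iff, ← LinearEquiv.range e'.symm, LinearMap.range_eq_map,
      ← (Pi.basisFun F (Fin m)).span_eq, Submodule.map_span, Submodule.span_le]
    rintro _ ⟨_, ⟨k, rfl⟩, rfl⟩
    refine Submodule.subset_span ⟨(e.symm (std F (p k).1), e.symm (std F (p k).2)), ?_⟩
    simp [hβ, hp]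
  · have h := LinearMap.congr_fun₂ hg (e l) (e k)
    simpa [hβ, W] using h

end Coordinates

/-! ### Coordinates on the algebras that are not given by a table -/

section Models

variable (F : Type u) [Field F]

/-- Coordinates on `H(1) ⊕ A(n)` in the basis `x₁, x₂, x` of `H(1)` and the standard basis of
`A(n)`. -/
def heisenbergOneProdEquiv (n : ℕ) : (H F 1 × A F n) ≃ₗ[F] (Fin (n + 3) → F) where
  toFun z := Matrix.vecCons (z.1.1 0) (Matrix.vecCons (z.1.2.1 0) (Matrix.vecCons z.1.2.2 z.2))
  invFun v := ((fun _ => v 0, fun _ => v 1, v 2), fun i => v i.succ.succ.succ)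
  map_add' z z' := by
    funext k
    refine Fin.cases rfl (Fin.cases rfl (Fin.cases rfl fun _ => rfl)) k
  map_smul' c z := by
    funext k
    refine Fin.cases rfl (Fin.cases rfl (Fin.cases rfl fun _ => rfl)) k
  left_inv z := by
    refine Prod.ext (Prod.ext ?_ (Prod.ext ?_ rfl)) rfl
    · funext i; rw [Subsingleton.elim i 0]; rfl
    · funext i; rw [Subsingleton.elim i 0]; rfl
  right_inv v := by
    funext k
    refine Fin.cases rfl (Fin.cases rfl (Fin.cases rfl fun _ => rfl)) k

theorem heisenbergOneProdEquiv_lie (n : ℕ) (x y : H F 1 × A F n) :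
    heisenbergOneProdEquiv F n ⁅x, y⁆ =
      pairing F [(0, 1, 2)] (heisenbergOneProdEquiv F n x) (heisenbergOneProdEquiv F n y) := by
  have h2 : (⁅x, y⁆ : H F 1 × A F n).1.2.2 = x.1.1 0 * y.1.2.1 0 - x.1.2.1 0 * y.1.1 0 :=
    Fin.sum_univ_one fun i => x.1.1 i * y.1.2.1 i - x.1.2.1 i * y.1.1 i
  funext k
  refine Fin.cases ?_ (Fin.cases ?_ (Fin.cases ?_ fun _ => ?_)) k
  · exact (add_zero (0 : F)).symm
  · exact (add_zero (0 : F)).symm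
  · exact h2.trans (add_zero _).symm
  · rw [pairing_apply, List.map_singleton, List.sum_singleton, if_neg]
    · rfl
    · intro h
      have h' : (2 : ℕ) % (n + 3) = _ := congrArg Fin.val h
      rw [Nat.mod_eq_of_lt (by omega)] at h'
      simp only [Fin.val_succ] at h'
      omega

/-- Coordinates on `H(2)` in the basis `x₁, x₂, x₃, x₄, x`. -/
def heisenbergTwoEquiv : H F 2 ≃ₗ[F] (Fin 5 → F) where
  toFun z := ![z.1 0, z.2.1 0, z.1 1, z.2.1 1, z.2.2]
  invFun v := (![v 0, v 2], ![v 1, v 3], v 4)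
  map_add' z z' := by funext k; fin_cases k <;> rfl
  map_smul' c z := by funext k; fin_cases k <;> rfl
  left_inv z := by
    refine Prod.ext ?_ (Prod.ext ?_ rfl) <;> funext i <;> fin_cases i <;> rfl
  right_inv v := by funext k; fin_cases k <;> rfl

theorem heisenbergTwoEquiv_lie (x y : H F 2) :
    heisenbergTwoEquiv F ⁅x, y⁆ = pairing F [(0, 1, 4), (2, 3, 4)] (heisenbergTwoEquiv F x)
      (heisenbergTwoEquiv F y) := by
  have h4 : (⁅x, y⁆ : H F 2).2.2 =
      (x.1 0 * y.2.1 0 - x.2.1 0 * y.1 0) + (x.1 1 * y.2.1 1 - x.2.1 1 * y.1 1) :=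
    Fin.sum_univ_two fun i => x.1 i * y.2.1 i - x.2.1 i * y.1 i
  funext k
  fin_cases k
  · simp [pairing_apply]; rfl
  · simp [pairing_apply]; rfl
  · simp [pairing_apply]; rfl
  · simp [pairing_apply]; rfl
  · exact h4.trans (congrArg _ (add_zero _).symm)

/-- Coordinates on `L_{4,3} ⊕ A(1)` in the basis `x₁, …, x₄` of `L_{4,3}` and that of `A(1)`. -/
def filiformProdEquiv : L5_3 F ≃ₗ[F] (Fin 5 → F) where
  toFun z := ![z.1 0, z.1 1, z.1 2, z.1 3, z.2 0]
  invFun v := (![v 0, v 1, v 2, v 3], ![v 4])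
  map_add' z z' := by funext k; fin_cases k <;> rfl
  map_smul' c z := by funext k; fin_cases k <;> rfl
  left_inv z := by
    refine Prod.ext ?_ ?_ <;> funext i <;> fin_cases i <;> rfl
  right_inv v := by funext k; fin_cases k <;> rfl

theorem filiformProdEquiv_lie (x y : L5_3 F) :
    filiformProdEquiv F ⁅x, y⁆ = pairing F [(0, 1, 2), (0, 2, 3)] (filiformProdEquiv F x)
      (filiformProdEquiv F y) := by
  have h : ∀ k, (⁅x, y⁆ : L5_3 F).1 k = T4_3.bracket F x.1 y.1 k := fun k => rfl
  funext k
  fin_cases k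
  · refine (h 0).trans ?_; simp [pairing_apply, Table.bracket, T4_3]
  · refine (h 1).trans ?_; simp [pairing_apply, Table.bracket, T4_3]
  · refine (h 2).trans ?_; simp [pairing_apply, Table.bracket, T4_3]; rfl
  · refine (h 3).trans ?_; simp [pairing_apply, Table.bracket, T4_3]; rfl
  · simp [pairing_apply]; rfl

end Models

/-! ### The nine exterior squares -/

section Cases

variable (F : Type u) [Field F]

theorem nonempty_exteriorSquare_L5_1_equiv :
    Nonempty (ExteriorSquare F (L5_1 F) ≃ₗ⁅F⁆ A F 10) := by
  refine nonempty_exteriorSquare_equiv_of_coordinates []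
    [(0, 1, 0), (0, 2, 1), (0, 3, 2), (0, 4, 3), (1, 2, 4), (1, 3, 5), (1, 4, 6),
      (2, 3, 7), (2, 4, 8), (3, 4, 9)] []
    ![(0, 1), (0, 2), (0, 3), (0, 4), (1, 2), (1, 3), (1, 4), (2, 3), (2, 4), (3, 4)]
    (LinearEquiv.refl F _) (fun _ _ => rfl)
    (LinearEquiv.refl F _) (fun _ _ => rfl) ?_ ?_ ?_ ?_
  · intro u v w
    funext k
    fin_cases k <;> simp [pairing_apply]
  · intro u v u' v'
    funext k
    fin_cases k <;> simp [pairing_apply]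
  · intro k
    fin_cases k <;> simp [pairing_std]
  · intro W h₀ hW i j hij
    fin_cases i <;> fin_cases j <;> simp [pairing_std, Pi.single_apply] at hij ⊢

theorem nonempty_exteriorSquare_L5_2_equiv :
    Nonempty (ExteriorSquare F (L5_2 F) ≃ₗ⁅F⁆ A F 8) := by
  refine nonempty_exteriorSquare_equiv_of_coordinates [(0, 1, 2)]
    [(0, 1, 0), (0, 2, 1), (0, 3, 2), (0, 4, 3), (1, 2, 4), (1, 3, 5), (1, 4, 6),
      (3, 4, 7)] []
    ![(0, 1), (0, 2), (0, 3), (0, 4), (1, 2), (1, 3), (1, 4), (3, 4)]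
    (heisenbergOneProdEquiv F 2) (heisenbergOneProdEquiv_lie F 2)
    (LinearEquiv.refl F _) (fun _ _ => rfl) ?_ ?_ ?_ ?_
  · intro u v w
    funext k
    fin_cases k <;> simp [pairing_apply] <;> ring
  · intro u v u' v'
    funext k
    fin_cases k <;> simp [pairing_apply]
  · intro k
    fin_cases k <;> simp [pairing_std]
  · intro W h₀ hW i j hij
    have h34 : W (std F 2) (std F 3) = 0 := by
      simpa [pairing_std, h₀] using
        hW (std F 0) (std F 1) (std F 3)
    have h35 : W (std F 2) (std F 4) = 0 := by
      simpa [pairing_std, h₀] using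
        hW (std F 0) (std F 1) (std F 4)
    fin_cases i <;> fin_cases j <;> simp [pairing_std, Pi.single_apply] at hij ⊢
    all_goals simp [h34, h35]

theorem nonempty_exteriorSquare_L5_3_equiv :
    Nonempty (ExteriorSquare F (L5_3 F) ≃ₗ⁅F⁆ A F 6) := by
  refine nonempty_exteriorSquare_equiv_of_coordinates [(0, 1, 2), (0, 2, 3)]
    [(0, 1, 0), (0, 2, 1), (0, 3, 2), (0, 4, 3), (1, 2, 4), (1, 4, 5)] []
    ![(0, 1), (0, 2), (0, 3), (0, 4), (1, 2), (1, 4)]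
    (filiformProdEquiv F) (filiformProdEquiv_lie F)
    (LinearEquiv.refl F _) (fun _ _ => rfl) ?_ ?_ ?_ ?_
  · intro u v w
    funext k
    fin_cases k <;> simp [pairing_apply] <;> ring
  · intro u v u' v'
    funext k
    fin_cases k <;> simp [pairing_apply]
  · intro k
    fin_cases k <;> simp [pairing_std]
  · intro W h₀ hW i j hij
    have h24 : W (std F 1) (std F 3) = 0 := by
      simpa [pairing_std, h₀] using
        hW (std F 0) (std F 1) (std F 2)
    have h34 : W (std F 2) (std F 3) = 0 := by
      simpa [pairing_std, h₀] using
        hW (std F 0) (std F 1) (std F 3)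
    have h35 : W (std F 2) (std F 4) = 0 := by
      simpa [pairing_std, h₀] using
        hW (std F 0) (std F 1) (std F 4)
    have h45 : W (std F 3) (std F 4) = 0 := by
      simpa [pairing_std, h₀] using
        hW (std F 0) (std F 2) (std F 4)
    fin_cases i <;> fin_cases j <;> simp [pairing_std, Pi.single_apply] at hij ⊢
    all_goals simp [h24, h34, h35, h45]

/-- In `H(2)` the centre is spanned by `x₅ = [x₁, x₂] = [x₃, x₄]`, and each `x_i` with `i ≤ 4`
commutes with one of these two pairs; hence `x_i ∧ x₅ = 0`. -/
theorem nonempty_exteriorSquare_L5_4_equiv :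
    Nonempty (ExteriorSquare F (L5_4 F) ≃ₗ⁅F⁆ A F 6) := by
  refine nonempty_exteriorSquare_equiv_of_coordinates [(0, 1, 4), (2, 3, 4)]
    [(0, 1, 0), (0, 2, 1), (0, 3, 2), (1, 2, 3), (1, 3, 4), (2, 3, 5)] []
    ![(0, 1), (0, 2), (0, 3), (1, 2), (1, 3), (2, 3)]
    (heisenbergTwoEquiv F) (heisenbergTwoEquiv_lie F)
    (LinearEquiv.refl F _) (fun _ _ => rfl) ?_ ?_ ?_ ?_
  · intro u v w
    funext k
    fin_cases k <;> simp [pairing_apply]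
  · intro u v u' v'
    funext k
    fin_cases k <;> simp [pairing_apply]
  · intro k
    fin_cases k <;> simp [pairing_std]
  · intro W h₀ hW i j hij
    have h15 : W (std F 0) (std F 4) = 0 := by
      simpa [pairing_std, h₀] using
        (hW (std F 0) (std F 2) (std F 3)).symm
    have h25 : W (std F 1) (std F 4) = 0 := by
      simpa [pairing_std, h₀] using
        (hW (std F 1) (std F 2) (std F 3)).symm
    have h35 : W (std F 2) (std F 4) = 0 := by
      simpa [pairing_std, h₀] using
        (hW (std F 2) (std F 0) (std F 1)).symm
    have h45 : W (std F 3) (std F 4) = 0 := by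
      simpa [pairing_std, h₀] using
        (hW (std F 3) (std F 0) (std F 1)).symm
    fin_cases i <;> fin_cases j <;> simp [pairing_std, Pi.single_apply] at hij ⊢
    all_goals simp [h15, h25, h35, h45]

theorem nonempty_exteriorSquare_L5_5_equiv :
    Nonempty (ExteriorSquare F (L5_5 F) ≃ₗ⁅F⁆ A F 6) := by
  refine nonempty_exteriorSquare_equiv_of_coordinates T5_5
    [(0, 1, 0), (0, 2, 1), (0, 3, 2), (0, 4, 3), (1, 2, 4), (1, 3, 5), (2, 3, 3)] []
    ![(0, 1), (0, 2), (0, 3), (0, 4), (1, 2), (1, 3)]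
    (LinearEquiv.refl F _) (fun _ _ => rfl)
    (LinearEquiv.refl F _) (fun _ _ => rfl) ?_ ?_ ?_ ?_
  · intro u v w
    funext k
    fin_cases k <;> simp [pairing_apply, T5_5] <;> ring
  · intro u v u' v'
    funext k
    fin_cases k <;> simp [pairing_apply, T5_5]
  · intro k
    fin_cases k <;> simp [pairing_std]
  · intro W h₀ hW i j hij
    have h25 : W (std F 1) (std F 4) = 0 := by
      simpa [pairing_std, h₀, T5_5] using
        hW (std F 0) (std F 1) (std F 2)
    have h34 : W (std F 2) (std F 3) = W (std F 0) (std F 4) := by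
      simpa [pairing_std, h₀, T5_5] using
        hW (std F 0) (std F 1) (std F 3)
    have h35 : W (std F 2) (std F 4) = 0 := by
      simpa [pairing_std, h₀, T5_5] using
        hW (std F 0) (std F 1) (std F 4)
    have h45 : W (std F 3) (std F 4) = 0 := by
      simpa [pairing_std, h₀, T5_5] using
        hW (std F 0) (std F 3) (std F 2)
    fin_cases i <;> fin_cases j <;> simp [pairing_std, Pi.single_apply] at hij ⊢
    all_goals simp [h25, h34, h35, h45]

/-- The factor `H(1)` is spanned by `x₁ ∧ x₂`, `x₁ ∧ x₃` and their bracket `x₃ ∧ x₄ = -x₂ ∧ x₅`. The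
remaining generators `x₁ ∧ x₄`, `x₁ ∧ x₅ = x₂ ∧ x₄`, `x₂ ∧ x₃` are central because
`x₃ ∧ x₅ = x₄ ∧ x₅ = 0`. -/
theorem nonempty_exteriorSquare_L5_6_equiv :
    Nonempty (ExteriorSquare F (L5_6 F) ≃ₗ⁅F⁆ (H F 1 × A F 3)) := by
  refine nonempty_exteriorSquare_equiv_of_coordinates T5_6
    [(0, 1, 0), (0, 2, 1), (2, 3, 2), (0, 3, 3), (0, 4, 4), (1, 2, 5), (1, 3, 4),
      (4, 1, 2)] [(0, 1, 2)]
    ![(0, 1), (0, 2), (2, 3), (0, 3), (0, 4), (1, 2)]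
    (LinearEquiv.refl F _) (fun _ _ => rfl)
    (heisenbergOneProdEquiv F 3) (heisenbergOneProdEquiv_lie F 3) ?_ ?_ ?_ ?_
  · intro u v w
    funext k
    fin_cases k <;> simp [pairing_apply, T5_6] <;> ring
  · intro u v u' v'
    funext k
    fin_cases k <;> simp [pairing_apply, T5_6]
  · intro k
    fin_cases k <;> simp [pairing_std]
  · intro W h₀ hW i j hij
    have h24 : W (std F 1) (std F 3) = W (std F 0) (std F 4) := by
      refine (sub_eq_zero.1 ?_).symm
      simpa [pairing_std, h₀, T5_6] using
        (hW (std F 0) (std F 1) (std F 2)).symm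
    have h34 : W (std F 2) (std F 3) = -W (std F 1) (std F 4) := by
      simpa [pairing_std, h₀, T5_6] using
        hW (std F 0) (std F 1) (std F 3)
    have h35 : W (std F 2) (std F 4) = 0 := by
      simpa [pairing_std, h₀, T5_6] using
        hW (std F 0) (std F 1) (std F 4)
    have h45 : W (std F 3) (std F 4) = 0 := by
      simpa [pairing_std, h₀, T5_6] using
        hW (std F 0) (std F 2) (std F 4)
    fin_cases i <;> fin_cases j <;> simp [pairing_std, Pi.single_apply] at hij ⊢
    all_goals simp [h24, h34, h35, h45]

/-- As for `L_{5,6}`, the factor `H(1)` is spanned by `x₁ ∧ x₂`, `x₁ ∧ x₃` and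
`x₃ ∧ x₄ = -x₂ ∧ x₅`; here `x₂ ∧ x₄ = 0`. -/
theorem nonempty_exteriorSquare_L5_7_equiv :
    Nonempty (ExteriorSquare F (L5_7 F) ≃ₗ⁅F⁆ (H F 1 × A F 3)) := by
  refine nonempty_exteriorSquare_equiv_of_coordinates T5_7
    [(0, 1, 0), (0, 2, 1), (2, 3, 2), (0, 3, 3), (0, 4, 4), (1, 2, 5), (4, 1, 2)] [(0, 1, 2)]
    ![(0, 1), (0, 2), (2, 3), (0, 3), (0, 4), (1, 2)]
    (LinearEquiv.refl F _) (fun _ _ => rfl)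
    (heisenbergOneProdEquiv F 3) (heisenbergOneProdEquiv_lie F 3) ?_ ?_ ?_ ?_
  · intro u v w
    funext k
    fin_cases k <;> simp [pairing_apply, T5_7] <;> ring
  · intro u v u' v'
    funext k
    fin_cases k <;> simp [pairing_apply, T5_7]
  · intro k
    fin_cases k <;> simp [pairing_std]
  · intro W h₀ hW i j hij
    have h24 : W (std F 1) (std F 3) = 0 := by
      simpa [pairing_std, h₀, T5_7] using
        hW (std F 0) (std F 1) (std F 2)
    have h34 : W (std F 2) (std F 3) = -W (std F 1) (std F 4) := by
      simpa [pairing_std, h₀, T5_7] using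
        hW (std F 0) (std F 1) (std F 3)
    have h35 : W (std F 2) (std F 4) = 0 := by
      simpa [pairing_std, h₀, T5_7] using
        hW (std F 0) (std F 1) (std F 4)
    have h45 : W (std F 3) (std F 4) = 0 := by
      simpa [pairing_std, h₀, T5_7] using
        hW (std F 0) (std F 2) (std F 4)
    fin_cases i <;> fin_cases j <;> simp [pairing_std, Pi.single_apply] at hij ⊢
    all_goals simp [h24, h34, h35, h45]

theorem nonempty_exteriorSquare_L5_8_equiv :
    Nonempty (ExteriorSquare F (L5_8 F) ≃ₗ⁅F⁆ A F 8) := by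
  refine nonempty_exteriorSquare_equiv_of_coordinates T5_8
    [(0, 1, 0), (0, 2, 1), (0, 3, 2), (0, 4, 3), (1, 2, 4), (1, 3, 5), (1, 4, 6),
      (2, 4, 7), (2, 3, 6)] []
    ![(0, 1), (0, 2), (0, 3), (0, 4), (1, 2), (1, 3), (1, 4), (2, 4)]
    (LinearEquiv.refl F _) (fun _ _ => rfl)
    (LinearEquiv.refl F _) (fun _ _ => rfl) ?_ ?_ ?_ ?_
  · intro u v w
    funext k
    fin_cases k <;> simp [pairing_apply, T5_8] <;> ring
  · intro u v u' v'
    funext k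
    fin_cases k <;> simp [pairing_apply, T5_8]
  · intro k
    fin_cases k <;> simp [pairing_std]
  · intro W h₀ hW i j hij
    have h34 : W (std F 2) (std F 3) = W (std F 1) (std F 4) := by
      simpa [pairing_std, h₀, T5_8, ← LinearMap.IsAlt.neg h₀ (std F 2)] using
        hW (std F 0) (std F 1) (std F 2)
    have h45 : W (std F 3) (std F 4) = 0 := by
      simpa [pairing_std, h₀, T5_8] using
        hW (std F 0) (std F 1) (std F 4)
    fin_cases i <;> fin_cases j <;> simp [pairing_std, Pi.single_apply] at hij ⊢
    all_goals simp [h34, h45]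

theorem nonempty_exteriorSquare_L5_9_equiv :
    Nonempty (ExteriorSquare F (L5_9 F) ≃ₗ⁅F⁆ A F 6) := by
  refine nonempty_exteriorSquare_equiv_of_coordinates T5_9
    [(0, 1, 0), (0, 2, 1), (0, 3, 2), (0, 4, 3), (1, 2, 4), (1, 4, 5), (1, 3, 3)] []
    ![(0, 1), (0, 2), (0, 3), (0, 4), (1, 2), (1, 4)]
    (LinearEquiv.refl F _) (fun _ _ => rfl)
    (LinearEquiv.refl F _) (fun _ _ => rfl) ?_ ?_ ?_ ?_
  · intro u v w
    funext k
    fin_cases k <;> simp [pairing_apply, T5_9] <;> ring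
  · intro u v u' v'
    funext k
    fin_cases k <;> simp [pairing_apply, T5_9]
  · intro k
    fin_cases k <;> simp [pairing_std]
  · intro W h₀ hW i j hij
    have h24 : W (std F 1) (std F 3) = W (std F 0) (std F 4) := by
      refine (sub_eq_zero.1 ?_).symm
      simpa [pairing_std, h₀, T5_9] using
        (hW (std F 0) (std F 1) (std F 2)).symm
    have h34 : W (std F 2) (std F 3) = 0 := by
      simpa [pairing_std, h₀, T5_9] using
        hW (std F 0) (std F 1) (std F 3)
    have h35 : W (std F 2) (std F 4) = 0 := by
      simpa [pairing_std, h₀, T5_9] using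
        hW (std F 0) (std F 1) (std F 4)
    have h45 : W (std F 3) (std F 4) = 0 := by
      simpa [pairing_std, h₀, T5_9] using
        hW (std F 0) (std F 2) (std F 4)
    fin_cases i <;> fin_cases j <;> simp [pairing_std, Pi.single_apply] at hij ⊢
    all_goals simp [h24, h34, h35, h45]

end Cases

end LieExt

theorem lemma2p8 (F : Type*) [Field F] :
    Nonempty (LieExt.ExteriorSquare F (LieExt.L5_1 F) ≃ₗ⁅F⁆ LieExt.A F 10) ∧
    Nonempty (LieExt.ExteriorSquare F (LieExt.L5_2 F) ≃ₗ⁅F⁆ LieExt.A F 8) ∧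
    Nonempty (LieExt.ExteriorSquare F (LieExt.L5_3 F) ≃ₗ⁅F⁆ LieExt.A F 6) ∧
    Nonempty (LieExt.ExteriorSquare F (LieExt.L5_4 F) ≃ₗ⁅F⁆ LieExt.A F 6) ∧
    Nonempty (LieExt.ExteriorSquare F (LieExt.L5_5 F) ≃ₗ⁅F⁆ LieExt.A F 6) ∧
    Nonempty (LieExt.ExteriorSquare F (LieExt.L5_6 F) ≃ₗ⁅F⁆ (LieExt.H F 1 × LieExt.A F 3)) ∧
    Nonempty (LieExt.ExteriorSquare F (LieExt.L5_7 F) ≃ₗ⁅F⁆ (LieExt.H F 1 × LieExt.A F 3)) ∧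
    Nonempty (LieExt.ExteriorSquare F (LieExt.L5_8 F) ≃ₗ⁅F⁆ LieExt.A F 8) ∧
    Nonempty (LieExt.ExteriorSquare F (LieExt.L5_9 F) ≃ₗ⁅F⁆ LieExt.A F 6) :=
  ⟨LieExt.nonempty_exteriorSquare_L5_1_equiv F,
    LieExt.nonempty_exteriorSquare_L5_2_equiv F,
    LieExt.nonempty_exteriorSquare_L5_3_equiv F,
    LieExt.nonempty_exteriorSquare_L5_4_equiv F,
    LieExt.nonempty_exteriorSquare_L5_5_equiv F,
    LieExt.nonempty_exteriorSquare_L5_6_equiv F,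
    LieExt.nonempty_exteriorSquare_L5_7_equiv F,
    LieExt.nonempty_exteriorSquare_L5_8_equiv F,
    LieExt.nonempty_exteriorSquare_L5_9_equiv F⟩
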